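/- Let $(M,g)$ and $(N,h)$ be smooth Riemannian manifolds (without boundary) of arbitrary finite dimensions $m$ and $n$, and let $\mathrm{vol}_g$ denote the Riemannian volume measure of $(M,g)$. For a smooth map $\varphi:M\to N$ put $$E_2(\varphi)=\frac12\int_M|\mathrm{d}\varphi|^2\,\mathrm{vol}_g\in[0,\infty],\qquad |\mathrm{d}\varphi|^2=\sum_{i=1}^m h(\mathrm{d}\varphi\,e_i,\mathrm{d}\varphi\,e_i)\ \text{ for } (e_i) \text{ a } g\text{-orthonormal frame}.$$ Let $\mathrm{SDiff}(M,g)$ be the set of smooth diffeomorphisms $\psi:M\to M$ which preserve $\mathrm{vol}_g$ and have compact support, the support being the closure of $\{x\in M:\psi(x)\neq x\}$. A smooth curve $\psi_t$ in $\mathrm{SDiff}(M,g)$, defined for $t$ in an open interval $I$, is a family of elements of $\mathrm{SDiff}(M,g)$ such that $(t,x)\mapsto\psi_t(x)$ is smooth on $I\times M$ and such that, for $t$ in any given compact subset of $I$, the supports of the $\psi_t$ lie in a common compact subset of $M$. A smooth map $\varphi:(M,g)\to(N,h)$ is called restricted harmonic if $E_2(\varphi)<\infty$ and, for every smooth curve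 $\psi_t$ in $\mathrm{SDiff}(M,g)$ defined for $t\in(-\varepsilon,\varepsilon)$, for some $\varepsilon>0$, with $\psi_0=\mathrm{id}_M$, the derivative below exists and $$\frac{d}{dt}\bigg|_{t=0}E_2(\varphi\circ\psi_t)=0 .$$ Corollary. Let $\varphi:(M,g)\to(N,h)$ be a smooth map with $E_2(\varphi)<\infty$ which is weakly conformal, that is, $\varphi^*h=f\,g$ for some function $f:M\to\mathbb{R}$. Then $\varphi$ is restricted harmonic. -/

import Mathlib

open scoped Manifold ContDiff
open MeasureTheory Set

noncomputable section

namespace RestrictedHarmonic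

/-- A smooth Riemannian metric on a manifold `M` modelled on `ℝᵐ` (without boundary):
a smooth family of inner products `g.inner x` on the tangent spaces of `M`. -/
abbrev Metric (m : ℕ) (M : Type*) [TopologicalSpace M]
    [ChartedSpace (EuclideanSpace ℝ (Fin m)) M] [IsManifold (𝓡 m) ∞ M] :=
  Bundle.ContMDiffRiemannianMetric (𝓡 m) ∞ (EuclideanSpace ℝ (Fin m))
    (fun x : M => TangentSpace (𝓡 m) x)

section Volume

variable {m : ℕ} {M : Type*} [TopologicalSpace M]
  [ChartedSpace (EuclideanSpace ℝ (Fin m)) M] [IsManifold (𝓡 m) ∞ M]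

/-- The `i`-th coordinate vector field `∂ᵢ` of the chart centred at `x₀`, at the point with
coordinates `u`. -/
def coordVec (x₀ : M) (u : EuclideanSpace ℝ (Fin m)) (i : Fin m) :
    TangentSpace (𝓡 m) ((chartAt (EuclideanSpace ℝ (Fin m)) x₀).symm u) :=
  mfderiv (𝓡 m) (𝓡 m) (chartAt (EuclideanSpace ℝ (Fin m)) x₀).symm u
    (EuclideanSpace.single i (1 : ℝ))

/-- The matrix `g(∂ᵢ, ∂ⱼ)` of the metric in the chart centred at `x₀`, at the coordinates `u`. -/
def chartGram (g : Metric m M) (x₀ : M) (u : EuclideanSpace ℝ (Fin m)) :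
    Matrix (Fin m) (Fin m) ℝ :=
  Matrix.of fun i j => g.inner _ (coordVec x₀ u i) (coordVec x₀ u j)

variable [MeasurableSpace M]

/-- The Riemannian volume on the domain of the chart centred at `x₀`, extended by zero to `M`:
the image of `√(det gᵢⱼ) du¹ ⋯ duᵐ` under the inverse of the chart. -/
def chartVolume (g : Metric m M) (x₀ : M) : Measure M :=
  Measure.map (chartAt (EuclideanSpace ℝ (Fin m)) x₀).symm
    ((volume.restrict (chartAt (EuclideanSpace ℝ (Fin m)) x₀).target).withDensity
      fun u => ENNReal.ofReal (Real.sqrt (chartGram g x₀ u).det))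

/-- The Riemannian volume measure `vol_g`: the least measure which is bounded below by the volume
of every chart domain. The measures `chartVolume g x₀` agree on overlaps of charts, so that on a
second countable manifold this is the measure which restricts to `chartVolume g x₀` on the domain
of the chart centred at `x₀`, for every `x₀`. -/
def riemannianVolume (g : Metric m M) : Measure M :=
  ⨆ x₀ : M, chartVolume g x₀

/-- `SDiff(M, g)`: the volume preserving smooth diffeomorphisms `ψ` of `M` of compact support,
the support being the closure of `{x | ψ x ≠ x}`. -/
def SDiff (g : Metric m M) : Set (M ≃ₘ^∞⟮𝓡 m, 𝓡 m⟯ M) :=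
  {ψ | MeasurePreserving ψ (riemannianVolume g) (riemannianVolume g) ∧
    IsCompact (closure {x : M | ψ x ≠ x})}

/-- `t ↦ ψ t` is a smooth curve in `SDiff(M, g)`, defined for `t` in the open set `I`: each `ψ t`
lies in `SDiff(M, g)`, the map `(t, x) ↦ ψ t x` is smooth, and for `t` in a compact subset of `I`
the supports of the `ψ t` lie in a common compact subset of `M`. -/
structure IsSmoothCurveInSDiff (g : Metric m M) (I : Set ℝ)
    (ψ : ℝ → M ≃ₘ^∞⟮𝓡 m, 𝓡 m⟯ M) : Prop where
  mem : ∀ t ∈ I, ψ t ∈ SDiff g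
  smooth : ContMDiffOn (𝓘(ℝ, ℝ).prod (𝓡 m)) (𝓡 m) ∞ (fun p : ℝ × M => ψ p.1 p.2) (I ×ˢ univ)
  support : ∀ J : Set ℝ, J ⊆ I → IsCompact J →
    ∃ K : Set M, IsCompact K ∧ ∀ t ∈ J, ∀ x ∉ K, ψ t x = x

end Volume

section Maps

variable {m n : ℕ} {M N : Type*}
  [TopologicalSpace M] [ChartedSpace (EuclideanSpace ℝ (Fin m)) M] [IsManifold (𝓡 m) ∞ M]
  [TopologicalSpace N] [ChartedSpace (EuclideanSpace ℝ (Fin n)) N] [IsManifold (𝓡 n) ∞ N]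

/-- The pullback `φ*h`: `(φ*h)ₓ(v, w) = h(dφₓ v, dφₓ w)`. -/
def pullback (h : Metric n N) (φ : M → N) (x : M) (v w : TangentSpace (𝓡 m) x) : ℝ :=
  h.inner (φ x) (mfderiv (𝓡 m) (𝓡 n) φ x v) (mfderiv (𝓡 m) (𝓡 n) φ x w)

/-- `φ` is weakly conformal: `φ*h = f g` for some function `f : M → ℝ`. -/
def IsWeaklyConformal (g : Metric m M) (h : Metric n N) (φ : M → N) : Prop :=
  ∃ f : M → ℝ, ∀ (x : M) (v w : TangentSpace (𝓡 m) x),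
    pullback h φ x v w = f x * g.inner x v w

/-- The standard basis of `ℝᵐ`, seen as a basis of `T_x M`. -/
def tangentBasis (m : ℕ) {M : Type*} [TopologicalSpace M]
    [ChartedSpace (EuclideanSpace ℝ (Fin m)) M] (x : M) (i : Fin m) : TangentSpace (𝓡 m) x :=
  (EuclideanSpace.single i (1 : ℝ) : EuclideanSpace ℝ (Fin m))

/-- `|dφ|²` at `x`, the trace `∑ᵢⱼ gⁱʲ (φ*h)ᵢⱼ` of `φ*h` with respect to `g`; equivalently
`∑ᵢ h(dφ eᵢ, dφ eᵢ)` for any `g`-orthonormal basis `eᵢ` of `T_x M`. -/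
def normSqDifferential (g : Metric m M) (h : Metric n N) (φ : M → N) (x : M) : ℝ :=
  Matrix.trace
    ((Matrix.of fun i j => g.inner x (tangentBasis m x i) (tangentBasis m x j))⁻¹ *
      Matrix.of fun i j => pullback h φ x (tangentBasis m x i) (tangentBasis m x j))

variable [MeasurableSpace M]

/-- The Dirichlet energy `E₂(φ) = ½ ∫_M |dφ|² vol_g`, with values in `[0, ∞]`. -/
def dirichletEnergy (g : Metric m M) (h : Metric n N) (φ : M → N) : ENNReal :=
  ∫⁻ x, ENNReal.ofReal (normSqDifferential g h φ x / 2) ∂(riemannianVolume g)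

/-- `φ : (M, g) → (N, h)` is restricted harmonic: it is smooth of finite Dirichlet energy, and
`d/dt E₂(φ ∘ ψ_t) = 0` at `t = 0` for every smooth curve `ψ_t` in `SDiff(M, g)` through
`ψ_0 = id`. The derivative is asserted to exist. -/
def IsRestrictedHarmonic (g : Metric m M) (h : Metric n N) (φ : M → N) : Prop :=
  ContMDiff (𝓡 m) (𝓡 n) ∞ φ ∧ dirichletEnergy g h φ ≠ ⊤ ∧
    ∀ (ε : ℝ) (ψ : ℝ → M ≃ₘ^∞⟮𝓡 m, 𝓡 m⟯ M), 0 < ε →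
      IsSmoothCurveInSDiff g (Ioo (-ε) ε) ψ → ψ 0 = Diffeomorph.refl (𝓡 m) M ∞ →
        HasDerivAt (fun t : ℝ => (dirichletEnergy g h (φ ∘ ψ t)).toReal) 0 0

end Maps

end RestrictedHarmonic

end

/-! If `φ*h = f g`, then `(φ ∘ ψ)*h = (f ∘ ψ) ψ*g`, so `|d(φ ∘ ψ)|² = (f ∘ ψ) |dψ|²`. For volume
preserving `ψ` the determinants of `ψ*g` and `g` in a chart agree
(`det_pullGram_eq_of_measurePreserving`), and the arithmetic-geometric mean inequality gives `|dψ|²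
≥ m`, with equality for the identity. As `f ≥ 0` when `m > 0`, a change of variables by `ψ` shows
that `φ` minimises the energy among all `φ ∘ ψ`.

A minimum forces the derivative to vanish only if it exists, so a matching upper bound is needed. In
a chart, `|dψ_t|²` is a `C¹` function of `(t, u)` which is minimal at `t = 0`, so its `t`-derivative
vanishes there. Strict differentiability and the common compact support turn this into `|dψ_t|² ≤ m
+ η|t|` on all of `M` for small `t` (`eventually_normSqDifferential_le`). Hence `E(φ) ≤ E(φ ∘ ψ_t) ≤
(1 + η|t|) E(φ)` for every `η > 0`, which yields existence and vanishing of the derivative at once.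
The integral is never differentiated, and no regularity of `f` is used. -/

noncomputable section

namespace RestrictedHarmonic

/-! ### Gram matrices and the arithmetic-geometric mean inequality -/

section LinearAlgebra

open Matrix

variable {ι : Type*} [Fintype ι]

/-- Neither family has to be independent, so this also covers pullbacks by maps with degenerate
differential. -/
lemma of_bilin_eq_transpose_mul_mul {V : Type*} [AddCommGroup V] [Module ℝ V]
    [TopologicalSpace V] [IsTopologicalAddGroup V] [ContinuousConstSMul ℝ V]
    (B : V →L[ℝ] V →L[ℝ] ℝ) (v w : ι → V) (A : Matrix ι ι ℝ)
    (h : ∀ i, v i = ∑ k, A k i • w k) :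
    (Matrix.of fun i j => B (v i) (v j)) = Aᵀ * (Matrix.of fun i j => B (w i) (w j)) * A := by
  ext i j
  simp only [Matrix.of_apply, h, map_sum, map_smul, Matrix.mul_apply, Matrix.transpose_apply,
    FunLike.coe_sum, Finset.sum_apply, FunLike.coe_smul, Pi.smul_apply,
    smul_eq_mul, Finset.sum_mul, Finset.mul_sum]
  refine Finset.sum_congr rfl fun k _ => Finset.sum_congr rfl fun l _ => ?_
  ring

lemma posDef_of_bilin {V : Type*} [AddCommGroup V] [Module ℝ V]
    [TopologicalSpace V] [IsTopologicalAddGroup V] [ContinuousConstSMul ℝ V]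
    (B : V →L[ℝ] V →L[ℝ] ℝ) (hsymm : ∀ v w, B v w = B w v) (hpos : ∀ v ≠ 0, 0 < B v v)
    {v : ι → V} (hv : LinearIndependent ℝ v) :
    (Matrix.of fun i j => B (v i) (v j)).PosDef := by
  refine Matrix.PosDef.of_dotProduct_mulVec_pos ?_ fun x hx => ?_
  · ext i j
    simp [hsymm (v i)]
  · have hne : ∑ i, x i • v i ≠ 0 := fun h0 =>
      hx (funext (Fintype.linearIndependent_iff.mp hv x h0))
    have := hpos _ hne
    simp only [map_sum, map_smul, FunLike.coe_sum, Finset.sum_apply,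
      FunLike.coe_smul, Pi.smul_apply, smul_eq_mul] at this
    simp only [dotProduct, Matrix.mulVec, Matrix.of_apply, Finset.mul_sum, star_trivial]
    simp only [Finset.mul_sum] at this
    refine this.trans_eq ?_
    refine Finset.sum_congr rfl fun i _ => Finset.sum_congr rfl fun j _ => ?_
    rw [hsymm (v i)]
    ring

variable [DecidableEq ι]

/-- A positive definite matrix of determinant one has trace at least its size. -/
lemma card_le_trace_of_det_eq_one {Q : Matrix ι ι ℝ} (hQ : Q.PosDef) (hdet : Q.det = 1) :
    (Fintype.card ι : ℝ) ≤ Q.trace := by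
  have hpos := hQ.eigenvalues_pos
  have htr : Q.trace = ∑ i, hQ.1.eigenvalues i := by
    simpa using hQ.1.trace_eq_sum_eigenvalues
  have hd : ∏ i, hQ.1.eigenvalues i = 1 := by
    have := hQ.1.det_eq_prod_eigenvalues
    rw [hdet] at this
    exact_mod_cast this.symm
  have hlog : ∑ i, Real.log (hQ.1.eigenvalues i) = 0 := by
    rw [← Real.log_prod (fun i _ => (hpos i).ne'), hd, Real.log_one]
  -- The inequality `log λ ≤ λ - 1` is summed over the eigenvalues, whose logarithms add up to `log
  -- det Q = 0`.
  have hle : ∑ i, Real.log (hQ.1.eigenvalues i) ≤ ∑ i, (hQ.1.eigenvalues i - 1) :=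
    Finset.sum_le_sum fun i _ => Real.log_le_sub_one_of_pos (hpos i)
  rw [hlog, Finset.sum_sub_distrib] at hle
  rw [htr]
  simp at hle
  exact hle

/-- The arithmetic-geometric mean inequality for a pair of positive definite matrices. -/
lemma card_le_trace_inv_mul {G P : Matrix ι ι ℝ} (hG : G.PosDef) (hP : P.PosDef)
    (hdet : P.det = G.det) : (Fintype.card ι : ℝ) ≤ (G⁻¹ * P).trace := by
  -- Writing `G = Bᴴ B` replaces `G⁻¹ P` by the positive definite matrix `B⁻ᴴ P B⁻¹`, which has the
  -- same trace by cyclicity and determinant one.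
  obtain ⟨B, hB, rfl⟩ : ∃ B : Matrix ι ι ℝ, IsUnit B ∧ G = Bᴴ * B := by
    open scoped MatrixOrder Matrix.Norms.L2Operator in
    exact CStarAlgebra.isStrictlyPositive_iff_eq_star_mul_self.mp hG.isStrictlyPositive
  have hBu : IsUnit B.det := (Matrix.isUnit_iff_isUnit_det B).mp hB
  have hQ : ((B⁻¹)ᴴ * P * B⁻¹).PosDef := by
    refine hP.conjTranspose_mul_mul_same ?_
    exact Matrix.mulVec_injective_of_isUnit ((Matrix.isUnit_nonsing_inv_iff).mpr hB)
  have htr : ((B⁻¹)ᴴ * P * B⁻¹).trace = ((Bᴴ * B)⁻¹ * P).trace := by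
    rw [Matrix.mul_inv_rev, Matrix.trace_mul_comm, ← Matrix.mul_assoc,
      Matrix.conjTranspose_nonsing_inv]
  rw [← htr]
  refine card_le_trace_of_det_eq_one hQ ?_
  have hne : B.det ≠ 0 := hBu.ne_zero
  rw [Matrix.det_mul, Matrix.det_mul, hdet, Matrix.det_mul, Matrix.det_conjTranspose,
    Matrix.det_conjTranspose, Matrix.det_nonsing_inv, Ring.inverse_eq_inv']
  simp
  field_simp

/-- The trace of one bilinear form with respect to another does not depend on the basis. -/
lemma trace_inv_mul_congr {G P A : Matrix ι ι ℝ} (hA : IsUnit A.det) :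
    ((Aᵀ * G * A)⁻¹ * (Aᵀ * P * A)).trace = (G⁻¹ * P).trace := by
  have hAt : IsUnit Aᵀ.det := by rwa [Matrix.det_transpose]
  have h : (Aᵀ * G * A)⁻¹ * (Aᵀ * P * A) = A⁻¹ * (G⁻¹ * P * A) := by
    rw [Matrix.mul_inv_rev, Matrix.mul_inv_rev]
    simp only [Matrix.mul_assoc]
    rw [Matrix.nonsing_inv_mul_cancel_left _ _ hAt]
  rw [h, Matrix.trace_mul_comm, Matrix.mul_assoc, Matrix.mul_nonsing_inv _ hA, Matrix.mul_one]

end LinearAlgebra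

/-! ### Matrices of endomorphisms of `ℝᵐ` -/

section Coordinates

variable {m : ℕ}

/-- The matrix of an endomorphism of `ℝᵐ` in the standard basis. -/
def stdMatrix (L : EuclideanSpace ℝ (Fin m) →L[ℝ] EuclideanSpace ℝ (Fin m)) :
    Matrix (Fin m) (Fin m) ℝ :=
  Matrix.of fun k i => L (EuclideanSpace.single i (1 : ℝ)) k

lemma det_stdMatrix (L : EuclideanSpace ℝ (Fin m) →L[ℝ] EuclideanSpace ℝ (Fin m)) :
    (stdMatrix L).det = L.det := by
  rw [ContinuousLinearMap.det, ← LinearMap.det_toMatrix (EuclideanSpace.basisFun (Fin m) ℝ).toBasis]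
  congr 1

lemma apply_single_eq_sum (L : EuclideanSpace ℝ (Fin m) →L[ℝ] EuclideanSpace ℝ (Fin m))
    (i : Fin m) :
    L (EuclideanSpace.single i (1 : ℝ)) =
      ∑ k, stdMatrix L k i • EuclideanSpace.single k (1 : ℝ) := by
  have := (EuclideanSpace.basisFun (Fin m) ℝ).sum_repr (L (EuclideanSpace.single i (1 : ℝ)))
  simpa [stdMatrix] using this.symm

lemma apply_apply_single {n : ℕ}
    (K : EuclideanSpace ℝ (Fin m) →L[ℝ] EuclideanSpace ℝ (Fin n))
    (L : EuclideanSpace ℝ (Fin m) →L[ℝ] EuclideanSpace ℝ (Fin m)) (i : Fin m) :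
    K (L (EuclideanSpace.single i (1 : ℝ))) =
      ∑ k, stdMatrix L k i • K (EuclideanSpace.single k (1 : ℝ)) := by
  rw [apply_single_eq_sum L, map_sum]
  simp only [map_smul]

lemma linearIndependent_apply_single
    {L : EuclideanSpace ℝ (Fin m) →L[ℝ] EuclideanSpace ℝ (Fin m)}
    (hL : Function.Injective L) :
    LinearIndependent ℝ fun i => L (EuclideanSpace.single i (1 : ℝ)) := by
  have hb := (EuclideanSpace.basisFun (Fin m) ℝ).toBasis.linearIndependent
  have := hb.map' L.toLinearMap (LinearMap.ker_eq_bot.mpr hL)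
  simpa [Function.comp_def] using this

lemma isUnit_det_stdMatrix_of_injective
    {L : EuclideanSpace ℝ (Fin m) →L[ℝ] EuclideanSpace ℝ (Fin m)}
    (hL : Function.Injective L) : IsUnit (stdMatrix L).det := by
  rw [det_stdMatrix]
  exact (LinearMap.isUnit_iff_isUnit_det _).mp
    ((LinearMap.isUnit_iff_ker_eq_bot _).mpr (LinearMap.ker_eq_bot.mpr hL))

end Coordinates

/-! ### Metrics and differentials in charts -/

section Charts

open scoped Topology

variable {m n : ℕ} {M N : Type*}
  [TopologicalSpace M] [ChartedSpace (EuclideanSpace ℝ (Fin m)) M] [IsManifold (𝓡 m) ∞ M]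
  [TopologicalSpace N] [ChartedSpace (EuclideanSpace ℝ (Fin n)) N] [IsManifold (𝓡 n) ∞ N]

/-- The matrix of `r*h` in the standard basis, for a map `r` defined on `ℝᵐ`. -/
def pullGram (h : Metric n N) (r : EuclideanSpace ℝ (Fin m) → N) (y : EuclideanSpace ℝ (Fin m)) :
    Matrix (Fin m) (Fin m) ℝ :=
  Matrix.of fun i j => pullback h r y (EuclideanSpace.single i (1 : ℝ))
    (EuclideanSpace.single j (1 : ℝ))

lemma chartGram_eq_pullGram (g : Metric m M) (x₀ : M) (u : EuclideanSpace ℝ (Fin m)) :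
    chartGram g x₀ u = pullGram g (chartAt (EuclideanSpace ℝ (Fin m)) x₀).symm u := rfl

lemma pullGram_congr (h : Metric n N) {r q : EuclideanSpace ℝ (Fin m) → N}
    {y : EuclideanSpace ℝ (Fin m)} (hrq : r =ᶠ[𝓝 y] q) : pullGram h r y = pullGram h q y := by
  have h1 : r y = q y := hrq.eq_of_nhds
  have h2 := hrq.mfderiv_eq (I := 𝓡 m) (I' := 𝓡 n)
  ext i j
  -- The form `h.inner (r y)` lives on a fibre depending on `r y`. Viewing all tangent spaces as the
  -- model space separates the base point from the differential, so that each can be rewritten.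
  change (fun (p : N) (L : EuclideanSpace ℝ (Fin m) →L[ℝ] EuclideanSpace ℝ (Fin n)) =>
    (h.inner p : EuclideanSpace ℝ (Fin n) →L[ℝ] EuclideanSpace ℝ (Fin n) →L[ℝ] ℝ)
      (L (EuclideanSpace.single i (1 : ℝ))) (L (EuclideanSpace.single j (1 : ℝ))))
      (r y) (mfderiv (𝓡 m) (𝓡 n) r y) = _
  rw [h1, h2]
  rfl

lemma pullGram_comp (h : Metric n N) {q : EuclideanSpace ℝ (Fin m) → N}
    {w : EuclideanSpace ℝ (Fin m) → EuclideanSpace ℝ (Fin m)} {y : EuclideanSpace ℝ (Fin m)}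
    (hq : MDifferentiableAt (𝓡 m) (𝓡 n) q (w y)) (hw : DifferentiableAt ℝ w y) :
    pullGram h (q ∘ w) y =
      (stdMatrix (fderiv ℝ w y)).transpose * pullGram h q (w y) * stdMatrix (fderiv ℝ w y) := by
  have hd : mfderiv (𝓡 m) (𝓡 n) (q ∘ w) y =
      (mfderiv (𝓡 m) (𝓡 n) q (w y)).comp (mfderiv (𝓡 m) (𝓡 m) w y) :=
    mfderiv_comp y hq hw.mdifferentiableAt
  refine of_bilin_eq_transpose_mul_mul (h.inner (q (w y)))
    (fun i => mfderiv (𝓡 m) (𝓡 n) (q ∘ w) y (EuclideanSpace.single i (1 : ℝ)))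
    (fun i => mfderiv (𝓡 m) (𝓡 n) q (w y) (EuclideanSpace.single i (1 : ℝ)))
    (stdMatrix (fderiv ℝ w y)) fun i => ?_
  rw [hd, mfderiv_eq_fderiv]
  exact apply_apply_single (mfderiv (𝓡 m) (𝓡 n) q (w y)) (fderiv ℝ w y) i

lemma linearIndependent_coordVec {x₀ : M} {u : EuclideanSpace ℝ (Fin m)}
    (hu : u ∈ (chartAt (EuclideanSpace ℝ (Fin m)) x₀).target) :
    LinearIndependent ℝ (coordVec (m := m) x₀ u) :=
  linearIndependent_apply_single
    ((mdifferentiable_chart (I := 𝓡 m) x₀).symm.mfderiv_injective hu)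

lemma posDef_chartGram (g : Metric m M) {x₀ : M} {u : EuclideanSpace ℝ (Fin m)}
    (hu : u ∈ (chartAt (EuclideanSpace ℝ (Fin m)) x₀).target) : (chartGram g x₀ u).PosDef :=
  posDef_of_bilin (g.inner _) (g.symm _) (fun v hv => g.pos _ v hv)
    (linearIndependent_coordVec hu)

/-- The norm of the differential, computed in a chart. -/
lemma normSqDifferential_chart_symm (g : Metric m M) (h : Metric n N) {φ : M → N} {x₀ : M}
    {u : EuclideanSpace ℝ (Fin m)}
    (hu : u ∈ (chartAt (EuclideanSpace ℝ (Fin m)) x₀).target)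
    (hφ : MDifferentiableAt (𝓡 m) (𝓡 n) φ
      ((chartAt (EuclideanSpace ℝ (Fin m)) x₀).symm u)) :
    normSqDifferential g h φ ((chartAt (EuclideanSpace ℝ (Fin m)) x₀).symm u) =
      ((chartGram g x₀ u)⁻¹ *
        pullGram h (φ ∘ (chartAt (EuclideanSpace ℝ (Fin m)) x₀).symm) u).trace := by
  set e := chartAt (EuclideanSpace ℝ (Fin m)) x₀ with he
  have hchart : e.MDifferentiable (𝓡 m) (𝓡 m) := mdifferentiable_chart x₀
  -- Since `T_x M` is the model space by definition, the derivative of the inverse chart is an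
  -- endomorphism of `ℝᵐ`. It transforms both Gram matrices by the same congruence, which the trace
  -- does not see.
  let L : EuclideanSpace ℝ (Fin m) →L[ℝ] EuclideanSpace ℝ (Fin m) :=
    mfderiv (𝓡 m) (𝓡 m) e.symm u
  have hL : IsUnit (stdMatrix L).det :=
    isUnit_det_stdMatrix_of_injective (hchart.symm.mfderiv_injective hu)
  have hG : chartGram g x₀ u = (stdMatrix L).transpose *
      (Matrix.of fun i j => g.inner (e.symm u) (tangentBasis m (e.symm u) i)
        (tangentBasis m (e.symm u) j)) * stdMatrix L :=
    of_bilin_eq_transpose_mul_mul (g.inner (e.symm u)) (coordVec x₀ u)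
      (tangentBasis m (e.symm u)) (stdMatrix L) fun i => apply_single_eq_sum L i
  have hd : mfderiv (𝓡 m) (𝓡 n) (φ ∘ e.symm) u =
      (mfderiv (𝓡 m) (𝓡 n) φ (e.symm u)).comp (mfderiv (𝓡 m) (𝓡 m) e.symm u) :=
    mfderiv_comp u hφ (hchart.mdifferentiableAt_symm hu)
  have hP : pullGram h (φ ∘ e.symm) u = (stdMatrix L).transpose *
      (Matrix.of fun i j => pullback h φ (e.symm u) (tangentBasis m (e.symm u) i)
        (tangentBasis m (e.symm u) j)) * stdMatrix L := by
    refine of_bilin_eq_transpose_mul_mul (h.inner (φ (e.symm u)))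
      (fun i => mfderiv (𝓡 m) (𝓡 n) (φ ∘ e.symm) u (EuclideanSpace.single i (1 : ℝ)))
      (fun i => mfderiv (𝓡 m) (𝓡 n) φ (e.symm u) (tangentBasis m (e.symm u) i))
      (stdMatrix L) fun i => ?_
    rw [hd]
    exact apply_apply_single (mfderiv (𝓡 m) (𝓡 n) φ (e.symm u)) L i
  rw [normSqDifferential, hG, hP, trace_inv_mul_congr hL]

/-- The coordinate fields are images of constant fields under the tangent map of the inverse chart,
hence smooth; the smooth metric is evaluated on them. -/
lemma contDiffOn_chartGram (g : Metric m M) (x₀ : M) (i j : Fin m) :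
    ContDiffOn ℝ ∞ (fun u => chartGram g x₀ u i j)
      (chartAt (EuclideanSpace ℝ (Fin m)) x₀).target := by
  set e := chartAt (EuclideanSpace ℝ (Fin m)) x₀ with he
  have hsymm : ContMDiffOn (𝓡 m) (𝓡 m) ∞ e.symm e.target := contMDiffOn_chart_symm
  have hT := hsymm.contMDiffOn_tangentMapWithin (m := ∞) (by norm_num)
    e.open_target.uniqueMDiffOn
  have hv : ∀ i : Fin m, ContMDiffOn (𝓡 m) ((𝓡 m).prod (𝓡 m)) ∞
      (fun u => (Bundle.TotalSpace.mk' (EuclideanSpace ℝ (Fin m)) (e.symm u)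
        (coordVec x₀ u i) : TangentBundle (𝓡 m) M)) e.target := by
    intro i
    have hc : ContMDiff (𝓡 m) ((𝓡 m).prod (𝓡 m)) ∞
        (fun u : EuclideanSpace ℝ (Fin m) => (Bundle.TotalSpace.mk' (EuclideanSpace ℝ (Fin m)) u
          (EuclideanSpace.single i (1 : ℝ)) :
            TangentBundle (𝓡 m) (EuclideanSpace ℝ (Fin m)))) := by
      exact contMDiff_vectorSpace_iff_contDiff.mpr contDiff_const
    refine (hT.comp hc.contMDiffOn fun u hu => hu).congr fun u hu => ?_
    simp only [Function.comp, tangentMapWithin, coordVec]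
    rw [mfderivWithin_of_isOpen e.open_target hu]
  have hg : ContMDiffOn (𝓡 m) ((𝓡 m).prod 𝓘(ℝ, EuclideanSpace ℝ (Fin m) →L[ℝ]
      EuclideanSpace ℝ (Fin m) →L[ℝ] ℝ)) ∞
      (fun u => Bundle.TotalSpace.mk' (EuclideanSpace ℝ (Fin m) →L[ℝ]
        EuclideanSpace ℝ (Fin m) →L[ℝ] ℝ)
        (E := fun x : M => TangentSpace (𝓡 m) x →L[ℝ] TangentSpace (𝓡 m) x →L[ℝ] ℝ)
        (e.symm u) (g.inner (e.symm u))) e.target :=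
    g.contMDiff.comp_contMDiffOn hsymm
  have : ContMDiffOn (𝓡 m) ((𝓡 m).prod 𝓘(ℝ, ℝ)) ∞
      (fun u => Bundle.TotalSpace.mk' ℝ (E := Bundle.Trivial M ℝ) (e.symm u)
        (g.inner (e.symm u) (coordVec x₀ u i) (coordVec x₀ u j))) e.target := by
    apply ContMDiffOn.clm_bundle_apply₂ (F₁ := EuclideanSpace ℝ (Fin m))
      (F₂ := EuclideanSpace ℝ (Fin m))
    · exact hg
    · exact hv i
    · exact hv j
  intro u hu
  have := this u hu
  simp only [Bundle.contMDiffWithinAt_totalSpace] at this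
  exact contMDiffWithinAt_iff_contDiffWithinAt.mp this.2

end Charts

/-! ### Riemannian volume and Jacobians of volume preserving maps -/

section VolumeInCharts

open scoped Topology

variable {m : ℕ} {M : Type*}
  [TopologicalSpace M] [ChartedSpace (EuclideanSpace ℝ (Fin m)) M]

/-- The expression of a map `ψ : M → M` in the charts centred at `x₀` and `x₁`. -/
def localRep (x₀ x₁ : M) (ψ : M → M) (u : EuclideanSpace ℝ (Fin m)) : EuclideanSpace ℝ (Fin m) :=
  chartAt (EuclideanSpace ℝ (Fin m)) x₁ (ψ ((chartAt (EuclideanSpace ℝ (Fin m)) x₀).symm u))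

/-- The points of the chart at `x₀` which `ψ` maps to the domain of the chart at `x₁`. -/
def localDomain (x₀ x₁ : M) (ψ : M → M) : Set (EuclideanSpace ℝ (Fin m)) :=
  (chartAt (EuclideanSpace ℝ (Fin m)) x₀).target ∩
    (chartAt (EuclideanSpace ℝ (Fin m)) x₀).symm ⁻¹'
      (ψ ⁻¹' (chartAt (EuclideanSpace ℝ (Fin m)) x₁).source)

lemma isOpen_localDomain (x₀ x₁ : M) {ψ : M → M} (hψ : Continuous ψ) :
    IsOpen (localDomain (m := m) x₀ x₁ ψ) :=
  (chartAt (EuclideanSpace ℝ (Fin m)) x₀).isOpen_inter_preimage_symm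
    (hψ.isOpen_preimage _ (chartAt (EuclideanSpace ℝ (Fin m)) x₁).open_source)

lemma measurableSet_target_inter_symm_preimage [MeasurableSpace M] [BorelSpace M] (x₀ : M)
    {A : Set M} (hA : MeasurableSet A) :
    MeasurableSet ((chartAt (EuclideanSpace ℝ (Fin m)) x₀).target ∩
      (chartAt (EuclideanSpace ℝ (Fin m)) x₀).symm ⁻¹' A) := by
  set e := chartAt (EuclideanSpace ℝ (Fin m)) x₀
  have hm := (continuousOn_iff_continuous_domRestrict.mp e.continuousOn_symm).measurable hA
  have := e.open_target.measurableSet.subtype_image hm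
  convert this using 1
  ext u
  simp [and_comm]

variable [IsManifold (𝓡 m) ∞ M]

lemma contDiffOn_localRep (x₀ x₁ : M) {ψ : M → M} (hψ : ContMDiff (𝓡 m) (𝓡 m) ∞ ψ) :
    ContDiffOn ℝ ∞ (localRep (m := m) x₀ x₁ ψ) (localDomain x₀ x₁ ψ) := by
  have h0 : ContMDiffOn (𝓡 m) (𝓡 m) ∞ (chartAt (EuclideanSpace ℝ (Fin m)) x₀).symm
    (chartAt (EuclideanSpace ℝ (Fin m)) x₀).target := contMDiffOn_chart_symm
  have h1 : ContMDiffOn (𝓡 m) (𝓡 m) ∞ (chartAt (EuclideanSpace ℝ (Fin m)) x₁)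
    (chartAt (EuclideanSpace ℝ (Fin m)) x₁).source := contMDiffOn_chart
  exact (h1.comp (hψ.comp_contMDiffOn (h0.mono inter_subset_left))
    fun u hu => hu.2).contDiffOn

lemma pullGram_eq_of_localRep (g : Metric m M) (x₀ x₁ : M) {ψ : M → M} (hψ : Continuous ψ)
    {u : EuclideanSpace ℝ (Fin m)} (hu : u ∈ localDomain x₀ x₁ ψ)
    (hw : DifferentiableAt ℝ (localRep x₀ x₁ ψ) u) :
    pullGram g (ψ ∘ (chartAt (EuclideanSpace ℝ (Fin m)) x₀).symm) u =
      (stdMatrix (fderiv ℝ (localRep x₀ x₁ ψ) u)).transpose *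
        chartGram g x₁ (localRep x₀ x₁ ψ u) * stdMatrix (fderiv ℝ (localRep x₀ x₁ ψ) u) := by
  have hev : ψ ∘ (chartAt (EuclideanSpace ℝ (Fin m)) x₀).symm =ᶠ[𝓝 u]
      (chartAt (EuclideanSpace ℝ (Fin m)) x₁).symm ∘ localRep x₀ x₁ ψ := by
    filter_upwards [(isOpen_localDomain x₀ x₁ hψ).mem_nhds hu] with v hv
    exact ((chartAt (EuclideanSpace ℝ (Fin m)) x₁).left_inv hv.2).symm
  rw [pullGram_congr g hev, chartGram_eq_pullGram]
  exact pullGram_comp g ((mdifferentiable_chart (I := 𝓡 m) x₁).mdifferentiableAt_symm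
    ((chartAt (EuclideanSpace ℝ (Fin m)) x₁).map_source hu.2)) hw

lemma differentiableAt_localRep {x₀ x₁ : M} {ψ : M → M} (hψ : ContMDiff (𝓡 m) (𝓡 m) ∞ ψ)
    {u : EuclideanSpace ℝ (Fin m)} (hu : u ∈ localDomain x₀ x₁ ψ) :
    DifferentiableAt ℝ (localRep x₀ x₁ ψ) u :=
  ((contDiffOn_localRep x₀ x₁ hψ).differentiableOn (by simp)).differentiableAt
    ((isOpen_localDomain x₀ x₁ hψ.continuous).mem_nhds hu)

/-- The square root of the squared Jacobian is the factor `|det|` in the change of variables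
formula. -/
lemma det_pullGram_of_localRep (g : Metric m M) {x₀ x₁ : M} {ψ : M → M}
    (hψ : ContMDiff (𝓡 m) (𝓡 m) ∞ ψ) {u : EuclideanSpace ℝ (Fin m)}
    (hu : u ∈ localDomain x₀ x₁ ψ) :
    (pullGram g (ψ ∘ (chartAt (EuclideanSpace ℝ (Fin m)) x₀).symm) u).det =
      (fderiv ℝ (localRep x₀ x₁ ψ) u).det ^ 2 * (chartGram g x₁ (localRep x₀ x₁ ψ u)).det := by
  rw [pullGram_eq_of_localRep g x₀ x₁ hψ.continuous hu (differentiableAt_localRep hψ hu),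
    Matrix.det_mul, Matrix.det_mul, Matrix.det_transpose, det_stdMatrix]
  ring

lemma det_pullGram_nonneg (g : Metric m M) (x₀ : M) {ψ : M → M}
    (hψ : ContMDiff (𝓡 m) (𝓡 m) ∞ ψ) {u : EuclideanSpace ℝ (Fin m)}
    (hu : u ∈ (chartAt (EuclideanSpace ℝ (Fin m)) x₀).target) :
    0 ≤ (pullGram g (ψ ∘ (chartAt (EuclideanSpace ℝ (Fin m)) x₀).symm) u).det := by
  have hu' : u ∈ localDomain x₀ (ψ ((chartAt (EuclideanSpace ℝ (Fin m)) x₀).symm u)) ψ :=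
    ⟨hu, mem_chart_source _ _⟩
  rw [det_pullGram_of_localRep g hψ hu']
  exact mul_nonneg (sq_nonneg _) (posDef_chartGram g
    ((chartAt (EuclideanSpace ℝ (Fin m)) _).map_source hu'.2)).det_pos.le

lemma continuousOn_chartGram_det (g : Metric m M) (x₀ : M) :
    ContinuousOn (fun u => (chartGram g x₀ u).det)
      (chartAt (EuclideanSpace ℝ (Fin m)) x₀).target := by
  have : ContinuousOn (fun u => chartGram g x₀ u)
      (chartAt (EuclideanSpace ℝ (Fin m)) x₀).target :=
    continuousOn_pi.mpr fun i => continuousOn_pi.mpr fun j =>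
      (contDiffOn_chartGram g x₀ i j).continuousOn
  exact (continuous_id.matrix_det).comp_continuousOn this

lemma continuousOn_pullGram_det (g : Metric m M) (x₀ x₁ : M) {ψ : M → M}
    (hψ : ContMDiff (𝓡 m) (𝓡 m) ∞ ψ) :
    ContinuousOn (fun u => (pullGram g (ψ ∘ (chartAt (EuclideanSpace ℝ (Fin m)) x₀).symm) u).det)
      (localDomain x₀ x₁ ψ) := by
  have hw := contDiffOn_localRep x₀ x₁ hψ
  have hd := hw.continuousOn_fderiv_of_isOpen (isOpen_localDomain x₀ x₁ hψ.continuous) (by simp)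
  have hG := (continuousOn_chartGram_det g x₁).comp hw.continuousOn fun u hu =>
    (chartAt (EuclideanSpace ℝ (Fin m)) x₁).map_source hu.2
  refine ((((ContinuousLinearMap.continuous_det).comp_continuousOn hd).pow 2).mul hG).congr
    fun u hu => ?_
  exact det_pullGram_of_localRep g hψ hu

variable [MeasurableSpace M] [BorelSpace M]

lemma chartVolume_apply (g : Metric m M) (x₀ : M) {A : Set M} (hA : MeasurableSet A) :
    chartVolume g x₀ A = ∫⁻ u in (chartAt (EuclideanSpace ℝ (Fin m)) x₀).target ∩
      (chartAt (EuclideanSpace ℝ (Fin m)) x₀).symm ⁻¹' A,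
        ENNReal.ofReal (Real.sqrt (chartGram g x₀ u).det) := by
  set e := chartAt (EuclideanSpace ℝ (Fin m)) x₀ with he
  have hmeas : AEMeasurable e.symm (volume.restrict e.target) :=
    e.continuousOn_symm.aemeasurable e.open_target.measurableSet
  rw [chartVolume, Measure.map_apply_of_aemeasurable
    (hmeas.mono_ac (withDensity_absolutelyContinuous _ _)) hA, withDensity_apply' ,
    Measure.restrict_restrict' e.open_target.measurableSet, inter_comm]

/-- Change of variables: the volume of `ψ '' A`, computed in the charts centred at `x₀`, `x₁`. -/
lemma chartVolume_image (g : Metric m M) (x₀ x₁ : M) (ψ : M ≃ₘ^∞⟮𝓡 m, 𝓡 m⟯ M) {A : Set M}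
    (hA : MeasurableSet A) (hA₀ : A ⊆ (chartAt (EuclideanSpace ℝ (Fin m)) x₀).source)
    (hA₁ : ∀ x ∈ A, ψ x ∈ (chartAt (EuclideanSpace ℝ (Fin m)) x₁).source) :
    chartVolume g x₁ (ψ '' A) = ∫⁻ u in (chartAt (EuclideanSpace ℝ (Fin m)) x₀).target ∩
      (chartAt (EuclideanSpace ℝ (Fin m)) x₀).symm ⁻¹' A,
        ENNReal.ofReal (Real.sqrt
          (pullGram g (ψ ∘ (chartAt (EuclideanSpace ℝ (Fin m)) x₀).symm) u).det) := by
  have hψA : MeasurableSet (ψ '' A) := ψ.toHomeomorph.measurableEmbedding.measurableSet_image' hA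
  rw [chartVolume_apply g x₁ hψA]
  set e₀ := chartAt (EuclideanSpace ℝ (Fin m)) x₀ with he₀
  set e₁ := chartAt (EuclideanSpace ℝ (Fin m)) x₁ with he₁
  set s := e₀.target ∩ e₀.symm ⁻¹' A with hs
  have hsub : s ⊆ localDomain x₀ x₁ ψ := fun u hu => ⟨hu.1, hA₁ _ hu.2⟩
  have himage : e₁.target ∩ e₁.symm ⁻¹' (ψ '' A) = localRep x₀ x₁ ψ '' s := by
    ext v
    constructor
    · rintro ⟨hv, x, hx, hxv⟩
      refine ⟨e₀ x, ⟨e₀.map_source (hA₀ hx), ?_⟩, ?_⟩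
      · rw [mem_preimage, e₀.left_inv (hA₀ hx)]
        exact hx
      · change e₁ (ψ (e₀.symm (e₀ x))) = v
        rw [e₀.left_inv (hA₀ hx), hxv, e₁.right_inv hv]
    · rintro ⟨u, hu, rfl⟩
      refine ⟨e₁.map_source (hA₁ _ hu.2), e₀.symm u, hu.2, ?_⟩
      exact (e₁.left_inv (hA₁ _ hu.2)).symm
  have hinj : InjOn (localRep x₀ x₁ ψ) s := fun u hu v hv huv =>
    e₀.symm.injOn hu.1 hv.1 (ψ.injective (e₁.injOn (hA₁ _ hu.2) (hA₁ _ hv.2) huv))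
  have hms : MeasurableSet s := measurableSet_target_inter_symm_preimage x₀ hA
  rw [himage, lintegral_image_eq_lintegral_abs_det_fderiv_mul volume hms
    (fun u hu => (differentiableAt_localRep ψ.contMDiff (hsub hu)).hasFDerivAt.hasFDerivWithinAt)
    hinj]
  refine setLIntegral_congr_fun hms fun u hu => ?_
  rw [det_pullGram_of_localRep g ψ.contMDiff (hsub hu), Real.sqrt_mul (sq_nonneg _),
    Real.sqrt_sq_eq_abs, ENNReal.ofReal_mul (abs_nonneg _)]

/-- The volumes of the chart domains agree on overlaps. -/
lemma chartVolume_eq_chartVolume (g : Metric m M) (x₀ x₁ : M) {A : Set M}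
    (hA : MeasurableSet A) (hA₀ : A ⊆ (chartAt (EuclideanSpace ℝ (Fin m)) x₀).source)
    (hA₁ : A ⊆ (chartAt (EuclideanSpace ℝ (Fin m)) x₁).source) :
    chartVolume g x₁ A = chartVolume g x₀ A := by
  -- This is the change of variables formula for the identity map.
  have := chartVolume_image g x₀ x₁ (Diffeomorph.refl (𝓡 m) M ∞) hA hA₀ hA₁
  rw [chartVolume_apply g x₀ hA]
  simpa [Diffeomorph.coe_refl, chartGram_eq_pullGram] using this

lemma chartVolume_le_inter_source (g : Metric m M) (x₀ : M) {A : Set M}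
    (hA : MeasurableSet A) :
    chartVolume g x₀ A ≤ chartVolume g x₀ (A ∩ (chartAt (EuclideanSpace ℝ (Fin m)) x₀).source) := by
  have hS := (chartAt (EuclideanSpace ℝ (Fin m)) x₀).open_source.measurableSet
  rw [chartVolume_apply g x₀ hA, chartVolume_apply g x₀ (hA.inter hS)]
  exact lintegral_mono_set fun u hu =>
    ⟨hu.1, hu.2, (chartAt (EuclideanSpace ℝ (Fin m)) x₀).map_target hu.1⟩

/-- On a chart domain, the Riemannian volume is the volume of the chart. -/
lemma riemannianVolume_eq_chartVolume (g : Metric m M) (x₀ : M) {A : Set M}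
    (hA : MeasurableSet A) (hA₀ : A ⊆ (chartAt (EuclideanSpace ℝ (Fin m)) x₀).source) :
    riemannianVolume g A = chartVolume g x₀ A := by
  set S := (chartAt (EuclideanSpace ℝ (Fin m)) x₀).source with hSdef
  have hS : MeasurableSet S := (chartAt (EuclideanSpace ℝ (Fin m)) x₀).open_source.measurableSet
  have hle : ∀ x₁, chartVolume g x₁ ≤ riemannianVolume g := fun x₁ => le_iSup _ x₁
  refine le_antisymm ?_ (hle x₀ A)
  -- A supremum of measures is bounded through a single measure dominating all of them. The second
  -- summand handles what lies off the chart domain and does not charge `A`.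
  have hbound : riemannianVolume g ≤
      chartVolume g x₀ + (riemannianVolume g).restrict Sᶜ := by
    refine iSup_le fun x₁ => Measure.le_iff.mpr fun B hB => ?_
    have hS₁ := (chartAt (EuclideanSpace ℝ (Fin m)) x₁).open_source.measurableSet
    calc chartVolume g x₁ B
        = chartVolume g x₁ (B ∩ S) + chartVolume g x₁ (B \ S) := (measure_inter_add_sdiff B hS).symm
      _ ≤ chartVolume g x₀ B + riemannianVolume g (B ∩ Sᶜ) := by
          refine add_le_add ?_ (hle x₁ _)
          refine (chartVolume_le_inter_source g x₁ (hB.inter hS)).trans ?_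
          rw [chartVolume_eq_chartVolume g x₀ x₁ ((hB.inter hS).inter hS₁)
            (fun x hx => hx.1.2) fun x hx => hx.2]
          exact measure_mono fun x hx => hx.1.1
      _ = (chartVolume g x₀ + (riemannianVolume g).restrict Sᶜ) B := by
          rw [Measure.add_apply, Measure.restrict_apply hB]
  refine (hbound A).trans ?_
  rw [Measure.add_apply, Measure.restrict_apply hA]
  have : A ∩ Sᶜ = ∅ := by
    rw [← sdiff_eq, sdiff_eq_empty]
    exact hA₀
  simp [this]

/-- A volume preserving diffeomorphism has Jacobian determinant one. -/
lemma det_pullGram_eq_of_measurePreserving (g : Metric m M) (ψ : M ≃ₘ^∞⟮𝓡 m, 𝓡 m⟯ M)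
    (hψ : MeasurePreserving ψ (riemannianVolume g) (riemannianVolume g)) (x₀ : M)
    {u : EuclideanSpace ℝ (Fin m)} (hu : u ∈ (chartAt (EuclideanSpace ℝ (Fin m)) x₀).target) :
    (pullGram g (ψ ∘ (chartAt (EuclideanSpace ℝ (Fin m)) x₀).symm) u).det =
      (chartGram g x₀ u).det := by
  set e₀ := chartAt (EuclideanSpace ℝ (Fin m)) x₀ with he₀
  set x₁ := ψ (e₀.symm u) with hx₁
  set U := localDomain (m := m) x₀ x₁ ψ with hU
  have hUo : IsOpen U := isOpen_localDomain x₀ x₁ ψ.continuous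
  have huU : u ∈ U := ⟨hu, mem_chart_source _ _⟩
  have hemb : MeasurableEmbedding ψ := ψ.toHomeomorph.measurableEmbedding
  let F := fun v => (pullGram g (ψ ∘ e₀.symm) v).det
  let G := fun v => (chartGram g x₀ v).det
  have hF : ContinuousOn F U := continuousOn_pullGram_det g x₀ x₁ ψ.contMDiff
  have hG : ContinuousOn G U := (continuousOn_chartGram_det g x₀).mono inter_subset_left
  have hF' : ContinuousOn (fun v => ENNReal.ofReal (Real.sqrt (F v))) U :=
    ENNReal.continuous_ofReal.comp_continuousOn (Real.continuous_sqrt.comp_continuousOn hF)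
  have hG' : ContinuousOn (fun v => ENNReal.ofReal (Real.sqrt (G v))) U :=
    ENNReal.continuous_ofReal.comp_continuousOn (Real.continuous_sqrt.comp_continuousOn hG)
  -- Volume preservation, tested on all Borel subsets of `U`, says that the two densities define the
  -- same measure. They are then equal almost everywhere, and everywhere on the open set `U` by
  -- continuity.
  have hint : (volume.restrict U).withDensity (fun v => ENNReal.ofReal (Real.sqrt (F v))) =
      (volume.restrict U).withDensity (fun v => ENNReal.ofReal (Real.sqrt (G v))) := by
    ext B hB
    rw [withDensity_apply _ hB, withDensity_apply _ hB, Measure.restrict_restrict hB]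
    set A := e₀ ⁻¹' (B ∩ U) ∩ e₀.source with hAdef
    have hA : MeasurableSet A := by
      have hm := (continuousOn_iff_continuous_domRestrict.mp e₀.continuousOn).measurable
        (hB.inter hUo.measurableSet)
      have := e₀.open_source.measurableSet.subtype_image hm
      convert this using 1
      ext x
      simp only [hAdef, mem_inter_iff, mem_preimage, mem_image, Subtype.exists, domRestrict_apply,
        exists_and_right, exists_eq_right]
      tauto
    have hs : B ∩ U = e₀.target ∩ e₀.symm ⁻¹' A := by
      ext v
      constructor
      · intro hv
        refine ⟨hv.2.1, ?_, e₀.map_target hv.2.1⟩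
        rw [mem_preimage, e₀.right_inv hv.2.1]
        exact hv
      · rintro ⟨hv, hv', -⟩
        rwa [mem_preimage, e₀.right_inv hv] at hv'
    have hA₀ : A ⊆ e₀.source := inter_subset_right
    have hA₁ : ∀ x ∈ A, ψ x ∈ (chartAt (EuclideanSpace ℝ (Fin m)) x₁).source := by
      rintro x ⟨hx, hx'⟩
      have := hx.2.2
      rwa [mem_preimage, mem_preimage, e₀.left_inv hx'] at this
    have h1 := chartVolume_image g x₀ x₁ ψ hA hA₀ hA₁
    have h2 := chartVolume_apply g x₀ hA
    have h3 : riemannianVolume g (ψ '' A) = riemannianVolume g A := by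
      rw [← hψ.measure_preimage_emb hemb (ψ '' A),
        hemb.injective.preimage_image]
    have hψA : MeasurableSet (ψ '' A) := hemb.measurableSet_image' hA
    rw [riemannianVolume_eq_chartVolume g x₁ hψA (image_subset_iff.mpr hA₁), riemannianVolume_eq_chartVolume g x₀ hA hA₀, h1, h2] at h3
    rw [hs]
    exact h3
  have hae := (withDensity_eq_iff_of_sigmaFinite (hF'.aemeasurable hUo.measurableSet)
    (hG'.aemeasurable hUo.measurableSet)).mp hint
  have heq := Measure.eqOn_open_of_ae_eq hae hUo hF' hG' huU
  have h4 := (ENNReal.ofReal_eq_ofReal_iff (Real.sqrt_nonneg _) (Real.sqrt_nonneg _)).mp heq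
  exact (Real.sqrt_inj (det_pullGram_nonneg g x₀ ψ.contMDiff hu)
    (posDef_chartGram g hu).det_pos.le).mp h4

end VolumeInCharts

/-! ### Differentiability of matrix operations -/

section MatrixSmoothness

variable {V ι : Type*} [NormedAddCommGroup V] [NormedSpace ℝ V] [Fintype ι]
  {k : WithTop ℕ∞} {x : V}

lemma contDiffAt_matrix_mul {A B : V → Matrix ι ι ℝ}
    (hA : ∀ i j, ContDiffAt ℝ k (fun y => A y i j) x)
    (hB : ∀ i j, ContDiffAt ℝ k (fun y => B y i j) x) (i j : ι) :
    ContDiffAt ℝ k (fun y => (A y * B y) i j) x := by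
  simp only [Matrix.mul_apply]
  exact ContDiffAt.sum fun l _ => (hA i l).mul (hB l j)

variable [DecidableEq ι]

lemma contDiffAt_det {A : V → Matrix ι ι ℝ} (hA : ∀ i j, ContDiffAt ℝ k (fun y => A y i j) x) :
    ContDiffAt ℝ k (fun y => (A y).det) x := by
  simp only [Matrix.det_apply]
  exact ContDiffAt.sum fun σ _ => (contDiffAt_prod fun i _ => hA _ _).const_smul _

/-- By Cramer's rule, the entries are determinants with one row made constant, divided by `det A`.
-/
lemma contDiffAt_inv_apply {A : V → Matrix ι ι ℝ}
    (hA : ∀ i j, ContDiffAt ℝ k (fun y => A y i j) x) (hx : (A x).det ≠ 0) (i j : ι) :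
    ContDiffAt ℝ k (fun y => (A y)⁻¹ i j) x := by
  simp only [Matrix.inv_def, Ring.inverse_eq_inv', Matrix.smul_apply, smul_eq_mul,
    Matrix.adjugate_apply]
  refine ((contDiffAt_det hA).inv hx).mul (contDiffAt_det fun a b => ?_)
  simp only [Matrix.updateRow_apply]
  split_ifs
  · exact contDiffAt_const
  · exact hA a b

end MatrixSmoothness

/-! ### A uniform first-order estimate at a minimum -/

section StrictDerivative

open scoped Topology

/-- A function `Φ (t, u)`, continuously differentiable at `(0, u₀)`, for which `0` is a minimum of
`t ↦ Φ (t, u₀)`, differs from `Φ (0, u)` by `o(t)`, uniformly for `u` near `u₀`. -/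
lemma eventually_le_add_of_isLocalMin {V : Type*} [NormedAddCommGroup V] [NormedSpace ℝ V]
    {Φ : ℝ × V → ℝ} {u₀ : V} (hΦ : ContDiffAt ℝ 1 Φ (0, u₀))
    (hmin : IsLocalMin (fun t : ℝ => Φ (t, u₀)) 0) {η : ℝ} (hη : 0 < η) :
    ∀ᶠ p : ℝ × V in 𝓝 (0, u₀), Φ p ≤ Φ (0, p.2) + η * |p.1| := by
  -- Strict differentiability allows both `p` and `(0, p.2)` to vary, which makes the estimate
  -- uniform in `u` although minimality is known only at `u₀`.
  have hs := hΦ.hasStrictFDerivAt one_ne_zero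
  set D := fderiv ℝ Φ (0, u₀)
  have hD : D (1, 0) = 0 := by
    have hc : HasDerivAt (fun t : ℝ => (t, u₀)) ((1 : ℝ), (0 : V)) 0 :=
      (hasDerivAt_id _).prodMk (hasDerivAt_const _ _)
    exact hmin.hasDerivAt_eq_zero (hs.hasFDerivAt.comp_hasDerivAt (0 : ℝ) hc)
  have ho := hs.isLittleO.def hη
  have ht : Filter.Tendsto (fun p : ℝ × V => (p, ((0 : ℝ), p.2))) (𝓝 (0, u₀))
      (𝓝 (((0 : ℝ), u₀), ((0 : ℝ), u₀))) := by
    have : Continuous (fun p : ℝ × V => (p, ((0 : ℝ), p.2))) := by fun_prop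
    exact this.tendsto (0, u₀)
  filter_upwards [ht.eventually ho] with p hp
  have hsub : p - ((0 : ℝ), p.2) = p.1 • ((1 : ℝ), (0 : V)) := by
    ext <;> simp
  simp only [hsub, map_smul, hD, smul_zero, sub_zero, norm_smul] at hp
  have hn : ‖((1 : ℝ), (0 : V))‖ = 1 := by simp [Prod.norm_def]
  rw [hn, mul_one, Real.norm_eq_abs, Real.norm_eq_abs] at hp
  linarith [le_abs_self (Φ p - Φ (0, p.2))]

end StrictDerivative

/-! ### Estimates for the differential of a volume preserving map -/

section Energy

open scoped Topology

variable {m n : ℕ} {M N : Type*}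
  [TopologicalSpace M] [ChartedSpace (EuclideanSpace ℝ (Fin m)) M] [IsManifold (𝓡 m) ∞ M]
  [TopologicalSpace N] [ChartedSpace (EuclideanSpace ℝ (Fin n)) N] [IsManifold (𝓡 n) ∞ N]

/-- This serves both for `ψ_0` and, off the common compact set, for every `ψ_t`. -/
lemma normSqDifferential_eq_of_eventuallyEq_id (g : Metric m M) {ψ : M → M} {x : M}
    (hψ : ψ =ᶠ[𝓝 x] id) : normSqDifferential g g ψ x = m := by
  set e := chartAt (EuclideanSpace ℝ (Fin m)) x with he
  have hx : x ∈ e.source := mem_chart_source _ x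
  have hu : e x ∈ e.target := e.map_source hx
  have hd : MDifferentiableAt (𝓡 m) (𝓡 m) ψ (e.symm (e x)) := by
    rw [e.left_inv hx]
    exact mdifferentiableAt_id.congr_of_eventuallyEq hψ
  have hev : ψ ∘ e.symm =ᶠ[𝓝 (e x)] e.symm := by
    have ht : Filter.Tendsto e.symm (𝓝 (e x)) (𝓝 x) := e.tendsto_symm hx
    filter_upwards [ht.eventually hψ] with u hu using hu
  have := normSqDifferential_chart_symm g g hu hd
  rw [e.left_inv hx, pullGram_congr g hev, ← chartGram_eq_pullGram,
    Matrix.nonsing_inv_mul _ (posDef_chartGram g hu).det_pos.ne'.isUnit, Matrix.trace_one,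
    Fintype.card_fin] at this
  exact this

lemma normSqDifferential_comp_of_conformal {g : Metric m M} {h : Metric n N} {φ : M → N}
    {f : M → ℝ} (hf : ∀ (x : M) (v w : TangentSpace (𝓡 m) x),
      pullback h φ x v w = f x * g.inner x v w) {ψ : M → M} {x : M}
    (hφ : MDifferentiableAt (𝓡 m) (𝓡 n) φ (ψ x)) (hψ : MDifferentiableAt (𝓡 m) (𝓡 m) ψ x) :
    normSqDifferential g h (φ ∘ ψ) x = f (ψ x) * normSqDifferential g g ψ x := by
  have hd : mfderiv (𝓡 m) (𝓡 n) (φ ∘ ψ) x =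
      (mfderiv (𝓡 m) (𝓡 n) φ (ψ x)).comp (mfderiv (𝓡 m) (𝓡 m) ψ x) := mfderiv_comp x hφ hψ
  have hP : (Matrix.of fun i j =>
      pullback h (φ ∘ ψ) x (tangentBasis m x i) (tangentBasis m x j)) =
      f (ψ x) • Matrix.of fun i j =>
        pullback g ψ x (tangentBasis m x i) (tangentBasis m x j) := by
    ext i j
    have := hf (ψ x) (mfderiv (𝓡 m) (𝓡 m) ψ x (tangentBasis m x i))
      (mfderiv (𝓡 m) (𝓡 m) ψ x (tangentBasis m x j))
    simp only [Matrix.of_apply, Matrix.smul_apply, smul_eq_mul]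
    rw [pullback, hd]
    exact this
  rw [normSqDifferential, hP, Matrix.mul_smul, Matrix.trace_smul, smul_eq_mul]
  rfl

lemma normSqDifferential_of_conformal {g : Metric m M} {h : Metric n N} {φ : M → N}
    {f : M → ℝ} (hf : ∀ (x : M) (v w : TangentSpace (𝓡 m) x),
      pullback h φ x v w = f x * g.inner x v w) {x : M}
    (hφ : MDifferentiableAt (𝓡 m) (𝓡 n) φ x) :
    normSqDifferential g h φ x = f x * m := by
  have := normSqDifferential_comp_of_conformal (ψ := id) hf hφ mdifferentiableAt_id
  rwa [normSqDifferential_eq_of_eventuallyEq_id g Filter.EventuallyEq.rfl] at this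

/-- Positivity of `m` supplies a nonzero test vector; in dimension zero `f` is unconstrained. -/
lemma conformal_factor_nonneg {g : Metric m M} {h : Metric n N} {φ : M → N}
    {f : M → ℝ} (hf : ∀ (x : M) (v w : TangentSpace (𝓡 m) x),
      pullback h φ x v w = f x * g.inner x v w) (hm : 0 < m) (x : M) : 0 ≤ f x := by
  let v : TangentSpace (𝓡 m) x := tangentBasis m x ⟨0, hm⟩
  have hv : v ≠ 0 := by
    intro h0
    have h1 : (EuclideanSpace.single (⟨0, hm⟩ : Fin m) (1 : ℝ)) = 0 := h0
    simp at h1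
  have hle : 0 ≤ pullback h φ x v v := by
    by_cases h0 : mfderiv (𝓡 m) (𝓡 n) φ x v = 0
    · simp [pullback, h0]
    · exact (h.pos _ _ h0).le
  rw [hf] at hle
  exact nonneg_of_mul_nonneg_left hle (g.pos x v hv)

/-- Near `t = 0`, the norm of the differential of `ψ t` in a chart is given by a
function of `(t, u)` which is continuously differentiable. -/
lemma exists_contDiffAt_normSqDifferential (g : Metric m M) {I : Set ℝ} (hI : IsOpen I)
    (h0 : (0 : ℝ) ∈ I) {ψ : ℝ → M ≃ₘ^∞⟮𝓡 m, 𝓡 m⟯ M}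
    (hsm : ContMDiffOn (𝓘(ℝ, ℝ).prod (𝓡 m)) (𝓡 m) ∞ (fun p : ℝ × M => ψ p.1 p.2) (I ×ˢ univ))
    (hψ0 : ψ 0 = Diffeomorph.refl (𝓡 m) M ∞) (x₀ : M) :
    ∃ Φ : ℝ × EuclideanSpace ℝ (Fin m) → ℝ,
      ContDiffAt ℝ 1 Φ (0, chartAt (EuclideanSpace ℝ (Fin m)) x₀ x₀) ∧
      ∀ᶠ p in 𝓝 ((0 : ℝ), chartAt (EuclideanSpace ℝ (Fin m)) x₀ x₀),
        normSqDifferential g g (ψ p.1) ((chartAt (EuclideanSpace ℝ (Fin m)) x₀).symm p.2) =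
          Φ p := by
  set e := chartAt (EuclideanSpace ℝ (Fin m)) x₀ with he
  have hx₀ : x₀ ∈ e.source := mem_chart_source _ x₀
  set u₀ := e x₀ with hu₀def
  have hu₀ : u₀ ∈ e.target := e.map_source hx₀
  have hsymm0 : e.symm u₀ = x₀ := e.left_inv hx₀
  have hψx : ψ 0 (e.symm u₀) = x₀ := by rw [hψ0, hsymm0]; rfl
  let Q : ℝ × EuclideanSpace ℝ (Fin m) → M := fun p => ψ p.1 (e.symm p.2)
  have hQ : ContMDiffAt 𝓘(ℝ, ℝ × EuclideanSpace ℝ (Fin m)) (𝓡 m) ∞ Q (0, u₀) := by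
    have hΨ : ContMDiffAt (𝓘(ℝ, ℝ).prod (𝓡 m)) (𝓡 m) ∞ (fun p : ℝ × M => ψ p.1 p.2)
        (0, e.symm u₀) :=
      hsm.contMDiffAt ((hI.prod isOpen_univ).mem_nhds ⟨h0, mem_univ _⟩)
    have hsym : ContMDiffAt (𝓡 m) (𝓡 m) ∞ e.symm u₀ :=
      (contMDiffOn_chart_symm (I := 𝓡 m) (x := x₀)).contMDiffAt (e.open_target.mem_nhds hu₀)
    have hfst : ContMDiffAt 𝓘(ℝ, ℝ × EuclideanSpace ℝ (Fin m)) 𝓘(ℝ, ℝ) ∞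
        (fun p : ℝ × EuclideanSpace ℝ (Fin m) => p.1) (0, u₀) := contDiffAt_fst.contMDiffAt
    have hsnd : ContMDiffAt 𝓘(ℝ, ℝ × EuclideanSpace ℝ (Fin m)) (𝓡 m) ∞
        (fun p : ℝ × EuclideanSpace ℝ (Fin m) => p.2) (0, u₀) := contDiffAt_snd.contMDiffAt
    have hpair := hfst.prodMk
      (ContMDiffAt.comp (g := e.symm) ((0 : ℝ), u₀) hsym hsnd)
    exact ContMDiffAt.comp (g := fun p : ℝ × M => ψ p.1 p.2) ((0 : ℝ), u₀) hΨ hpair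
  let W : ℝ × EuclideanSpace ℝ (Fin m) → EuclideanSpace ℝ (Fin m) := fun p => e (Q p)
  have hQ0 : Q (0, u₀) = x₀ := hψx
  have hW : ContDiffAt ℝ ∞ W (0, u₀) := by
    have he' : ContMDiffAt (𝓡 m) (𝓡 m) ∞ e (Q (0, u₀)) := by
      rw [hQ0]
      exact (contMDiffOn_chart (I := 𝓡 m) (x := x₀)).contMDiffAt (e.open_source.mem_nhds hx₀)
    exact (ContMDiffAt.comp ((0 : ℝ), u₀) he' hQ).contDiffAt
  have hW0 : W (0, u₀) = u₀ := by
    change e (Q (0, u₀)) = u₀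
    rw [hQ0]
  let J : ℝ × EuclideanSpace ℝ (Fin m) → Matrix (Fin m) (Fin m) ℝ := fun p =>
    stdMatrix (fderiv ℝ (fun v => W (p.1, v)) p.2)
  have hJ : ∀ i j, ContDiffAt ℝ 1 (fun p => J p i j) (0, u₀) := by
    intro i j
    -- One of the two derivatives is spent on the Jacobian, leaving `J` of class `C¹`.
    have hf : ContDiffAt ℝ 2 (Function.uncurry
        fun (p : ℝ × EuclideanSpace ℝ (Fin m)) v => W (p.1, v)) ((0, u₀), u₀) := by
      have hl : ContDiffAt ℝ 2 (fun q : (ℝ × EuclideanSpace ℝ (Fin m)) ×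
          EuclideanSpace ℝ (Fin m) => (q.1.1, q.2)) ((0, u₀), u₀) := by fun_prop
      exact ContDiffAt.comp (g := W) _ (contDiffAt_infty.mp hW 2) hl
    have hfd : ContDiffAt ℝ 1 (fun p : ℝ × EuclideanSpace ℝ (Fin m) =>
        fderiv ℝ (fun v => W (p.1, v)) p.2) (0, u₀) :=
      ContDiffAt.fderiv (g := fun p : ℝ × EuclideanSpace ℝ (Fin m) => p.2) hf contDiffAt_snd
        (by norm_num)
    have happ := hfd.clm_apply
      (contDiffAt_const (c := (EuclideanSpace.single j (1 : ℝ) : EuclideanSpace ℝ (Fin m))))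
    exact (contDiffAt_piLp _).mp happ i
  have hGat : ∀ i j, ContDiffAt ℝ 1 (fun u => chartGram g x₀ u i j) u₀ := fun i j =>
    ((contDiffOn_chartGram g x₀ i j).contDiffAt (e.open_target.mem_nhds hu₀)).of_le
      (by exact_mod_cast le_top)
  have hGW : ∀ i j, ContDiffAt ℝ 1 (fun p => chartGram g x₀ (W p) i j) (0, u₀) := by
    intro i j
    have h1 : ContDiffAt ℝ 1 (fun u => chartGram g x₀ u i j) (W (0, u₀)) := by
      rw [hW0]
      exact hGat i j
    exact ContDiffAt.comp (g := fun u => chartGram g x₀ u i j) _ h1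
      (hW.of_le (by exact_mod_cast le_top))
  have hG2 : ∀ i j, ContDiffAt ℝ 1
      (fun p : ℝ × EuclideanSpace ℝ (Fin m) => chartGram g x₀ p.2 i j) (0, u₀) := fun i j =>
    ContDiffAt.comp (g := fun u => chartGram g x₀ u i j) ((0 : ℝ), u₀) (hGat i j) contDiffAt_snd
  have hGinv := contDiffAt_inv_apply hG2 (posDef_chartGram g hu₀).det_pos.ne'
  refine ⟨fun p => ((chartGram g x₀ p.2)⁻¹ *
    ((J p).transpose * chartGram g x₀ (W p) * J p)).trace, ?_, ?_⟩
  · simp only [Matrix.trace, Matrix.diag_apply]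
    refine ContDiffAt.sum fun i _ => contDiffAt_matrix_mul hGinv (fun a b => ?_) i i
    exact contDiffAt_matrix_mul (contDiffAt_matrix_mul (fun a b => hJ b a) hGW) hJ a b
  -- Since `ψ_0 = id`, nearby `(t, u)` stay in the chart at `x₀`, so one chart serves for source and
  -- target.
  · have hsrc : ∀ᶠ p in 𝓝 ((0 : ℝ), u₀), Q p ∈ e.source := by
      refine hQ.continuousAt.eventually_mem (e.open_source.mem_nhds ?_)
      rw [hQ0]
      exact hx₀
    have htgt : ∀ᶠ p : ℝ × EuclideanSpace ℝ (Fin m) in 𝓝 ((0 : ℝ), u₀), p.2 ∈ e.target :=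
      continuousAt_snd.eventually_mem (e.open_target.mem_nhds hu₀)
    filter_upwards [hsrc, htgt] with p hp hpt
    have hdom : p.2 ∈ localDomain x₀ x₀ (ψ p.1) := ⟨hpt, hp⟩
    rw [normSqDifferential_chart_symm g g hpt ((ψ p.1).mdifferentiable (by simp) _),
      pullGram_eq_of_localRep g x₀ x₀ (ψ p.1).continuous hdom
        (differentiableAt_localRep (ψ p.1).contMDiff hdom)]
    rfl

variable [MeasurableSpace M] [BorelSpace M]

/-- The differential of a volume preserving diffeomorphism has norm at least that of the
identity. -/
lemma le_normSqDifferential_of_mem_SDiff (g : Metric m M) {ψ : M ≃ₘ^∞⟮𝓡 m, 𝓡 m⟯ M}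
    (hψ : ψ ∈ SDiff g) (x : M) : (m : ℝ) ≤ normSqDifferential g g ψ x := by
  set e := chartAt (EuclideanSpace ℝ (Fin m)) x with he
  have hx : x ∈ e.source := mem_chart_source _ x
  have hu : e x ∈ e.target := e.map_source hx
  have hdet := det_pullGram_eq_of_measurePreserving g ψ hψ.1 x hu
  have hG := posDef_chartGram g hu
  have hdom : e x ∈ localDomain x (ψ x) ψ := by
    refine ⟨hu, ?_⟩
    rw [mem_preimage, mem_preimage, ← he, e.left_inv hx]
    exact mem_chart_source _ _
  have hdiff := differentiableAt_localRep ψ.contMDiff hdom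
  have hP : (pullGram g (ψ ∘ e.symm) (e x)).PosDef := by
    -- A singular Jacobian would contradict `hdet`, because `det G > 0`.
    have hne : (fderiv ℝ (localRep x (ψ x) ψ) (e x)).det ≠ 0 := by
      intro h0
      have := det_pullGram_of_localRep g ψ.contMDiff hdom
      rw [hdet, h0] at this
      simp [hG.det_pos.ne'] at this
    rw [pullGram_eq_of_localRep g x (ψ x) ψ.continuous hdom hdiff]
    have hG₁ := posDef_chartGram g
      ((chartAt (EuclideanSpace ℝ (Fin m)) (ψ x)).map_source hdom.2)
    rw [← Matrix.conjTranspose_eq_transpose_of_trivial]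
    refine hG₁.conjTranspose_mul_mul_same (Matrix.mulVec_injective_of_isUnit ?_)
    rw [Matrix.isUnit_iff_isUnit_det, det_stdMatrix]
    exact hne.isUnit
  have hle := card_le_trace_inv_mul hG hP hdet
  rw [Fintype.card_fin, ← normSqDifferential_chart_symm g g hu
    (ψ.mdifferentiable (by simp) _), e.left_inv hx] at hle
  exact hle

/-- Along a curve in `SDiff(M, g)` through the identity, `|dψ_t|² ≤ m + o(t)`, uniformly on `M`. -/
lemma eventually_normSqDifferential_le [T2Space M] (g : Metric m M) {ε : ℝ} (hε : 0 < ε)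
    {ψ : ℝ → M ≃ₘ^∞⟮𝓡 m, 𝓡 m⟯ M} (hψ : IsSmoothCurveInSDiff g (Ioo (-ε) ε) ψ)
    (hψ0 : ψ 0 = Diffeomorph.refl (𝓡 m) M ∞) {η : ℝ} (hη : 0 < η) :
    ∀ᶠ t in 𝓝 (0 : ℝ), ∀ x, normSqDifferential g g (ψ t) x ≤ m + η * |t| := by
  have h0 : (0 : ℝ) ∈ Ioo (-ε) ε := ⟨by linarith, hε⟩
  have hId : ∀ x, normSqDifferential g g (ψ 0) x = m := fun x =>
    normSqDifferential_eq_of_eventuallyEq_id g (by rw [hψ0]; exact Filter.EventuallyEq.rfl)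
  have hloc : ∀ x₀ : M, ∀ᶠ p : ℝ × M in 𝓝 (0, x₀),
      normSqDifferential g g (ψ p.1) p.2 ≤ m + η * |p.1| := by
    intro x₀
    obtain ⟨Φ, hΦ, heq⟩ := exists_contDiffAt_normSqDifferential g isOpen_Ioo h0 hψ.smooth hψ0 x₀
    set e := chartAt (EuclideanSpace ℝ (Fin m)) x₀ with he
    have hx₀ : x₀ ∈ e.source := mem_chart_source _ x₀
    have hline : ∀ᶠ t : ℝ in 𝓝 0,
        normSqDifferential g g (ψ t) (e.symm (e x₀)) = Φ (t, e x₀) := by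
      have hc : ContinuousAt (fun t : ℝ => (t, e x₀)) 0 := by fun_prop
      exact hc.eventually heq
    have hslice : ∀ᶠ p : ℝ × EuclideanSpace ℝ (Fin m) in 𝓝 (0, e x₀),
        normSqDifferential g g (ψ 0) (e.symm p.2) = Φ (0, p.2) := by
      have hc : ContinuousAt (fun p : ℝ × EuclideanSpace ℝ (Fin m) => ((0 : ℝ), p.2))
        (0, e x₀) := by fun_prop
      exact hc.eventually heq
    -- Volume preservation enters here: `m` is a lower bound for every `t` and is attained at `t =
    -- 0`.
    have hmin : IsLocalMin (fun t : ℝ => Φ (t, e x₀)) 0 := by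
      filter_upwards [hline, isOpen_Ioo.mem_nhds h0] with t ht htI
      rw [← ht, ← hline.self_of_nhds, hId]
      exact le_normSqDifferential_of_mem_SDiff g (hψ.mem t htI) _
    have hbound := eventually_le_add_of_isLocalMin hΦ hmin hη
    have htend : ContinuousAt (fun p : ℝ × M => (p.1, e p.2)) (0, x₀) :=
      continuousAt_fst.prodMk ((e.continuousAt hx₀).comp' continuousAt_snd)
    have hsrc : ∀ᶠ p : ℝ × M in 𝓝 ((0 : ℝ), x₀), p.2 ∈ e.source :=
      continuousAt_snd.eventually_mem (e.open_source.mem_nhds hx₀)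
    filter_upwards [htend.eventually hbound, htend.eventually heq, htend.eventually hslice, hsrc]
      with p h1 h2 h3 h4
    rw [← h2, ← h3, hId, e.left_inv h4] at h1
    exact h1
  have hJ : Icc (-(ε / 2)) (ε / 2) ⊆ Ioo (-ε) ε := fun t ht =>
    ⟨by linarith [ht.1], by linarith [ht.2]⟩
  obtain ⟨K, hK, hKψ⟩ := hψ.support _ hJ isCompact_Icc
  -- Compactness of `K` makes one neighbourhood of `t = 0` work for all its points. Off the closed
  -- set `K`, each `ψ_t` is the identity near the point.
  have hcpt := hK.eventually_forall_of_forall_eventually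
    (P := fun t x => normSqDifferential g g (ψ t) x ≤ m + η * |t|) fun x _ => hloc x
  have hsmall : Icc (-(ε / 2)) (ε / 2) ∈ 𝓝 (0 : ℝ) :=
    Icc_mem_nhds (by linarith) (by linarith)
  filter_upwards [hcpt, hsmall] with t ht htJ x
  by_cases hx : x ∈ K
  · exact ht x hx
  · rw [normSqDifferential_eq_of_eventuallyEq_id g]
    · have : 0 ≤ η * |t| := by positivity
      linarith
    · filter_upwards [hK.isClosed.isOpen_compl.mem_nhds hx] with y hy
      exact hKψ t htJ y hy

end Energy

/-! ### Energy bounds and the derivative at zero -/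

section RestrictedHarmonicity

open scoped Topology

variable {m n : ℕ} {M N : Type*}
  [TopologicalSpace M] [ChartedSpace (EuclideanSpace ℝ (Fin m)) M] [IsManifold (𝓡 m) ∞ M]
  [TopologicalSpace N] [ChartedSpace (EuclideanSpace ℝ (Fin n)) N] [IsManifold (𝓡 n) ∞ N]
  [MeasurableSpace M] [BorelSpace M]

/-- Among the compositions with volume preserving diffeomorphisms, a weakly conformal map
minimises the energy. -/
lemma dirichletEnergy_le_comp {g : Metric m M} {h : Metric n N} {φ : M → N}
    (hφ : ContMDiff (𝓡 m) (𝓡 n) ∞ φ) (hconf : IsWeaklyConformal g h φ) (hm : 0 < m)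
    {ψ : M ≃ₘ^∞⟮𝓡 m, 𝓡 m⟯ M} (hψ : ψ ∈ SDiff g) :
    dirichletEnergy g h φ ≤ dirichletEnergy g h (φ ∘ ψ) := by
  obtain ⟨f, hf⟩ := hconf
  -- Pulling the energy of `φ` back by `ψ` puts the factor `f (ψ x)` into both integrands, which are
  -- then compared pointwise.
  rw [dirichletEnergy, ← hψ.1.lintegral_comp_emb ψ.toHomeomorph.measurableEmbedding]
  refine lintegral_mono fun x => ENNReal.ofReal_le_ofReal ?_
  rw [normSqDifferential_comp_of_conformal hf (hφ.mdifferentiableAt (by simp))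
    (ψ.mdifferentiable (by simp) x),
    normSqDifferential_of_conformal hf (hφ.mdifferentiableAt (by simp))]
  have := mul_le_mul_of_nonneg_left (le_normSqDifferential_of_mem_SDiff g hψ x)
    (conformal_factor_nonneg hf hm (ψ x))
  linarith

lemma dirichletEnergy_comp_le {g : Metric m M} {h : Metric n N} {φ : M → N}
    (hφ : ContMDiff (𝓡 m) (𝓡 n) ∞ φ) (hconf : IsWeaklyConformal g h φ) (hm : 0 < m)
    {ψ : M ≃ₘ^∞⟮𝓡 m, 𝓡 m⟯ M} (hψ : ψ ∈ SDiff g) {c : ℝ} (hc : 0 ≤ c)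
    (hle : ∀ x, normSqDifferential g g ψ x ≤ m + c) :
    dirichletEnergy g h (φ ∘ ψ) ≤ ENNReal.ofReal (1 + c) * dirichletEnergy g h φ := by
  obtain ⟨f, hf⟩ := hconf
  rw [dirichletEnergy, dirichletEnergy,
    ← hψ.1.lintegral_comp_emb ψ.toHomeomorph.measurableEmbedding
      (fun x => ENNReal.ofReal (normSqDifferential g h φ x / 2)),
    ← lintegral_const_mul' _ _ ENNReal.ofReal_ne_top]
  refine lintegral_mono fun x => ?_
  rw [← ENNReal.ofReal_mul (by linarith)]
  refine ENNReal.ofReal_le_ofReal ?_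
  rw [normSqDifferential_comp_of_conformal hf (hφ.mdifferentiableAt (by simp))
    (ψ.mdifferentiable (by simp) x),
    normSqDifferential_of_conformal hf (hφ.mdifferentiableAt (by simp))]
  -- From `m ≥ 1`, the additive bound `m + c` is at most `(1 + c) m`, a multiple of the value for
  -- the identity.
  have hm1 : (1 : ℝ) ≤ m := by exact_mod_cast hm
  have h1 : normSqDifferential g g ψ x ≤ (1 + c) * m := (hle x).trans (by nlinarith)
  have := mul_le_mul_of_nonneg_left h1 (conformal_factor_nonneg hf hm (ψ x))
  linarith

lemma hasDerivAt_dirichletEnergy_comp [T2Space M] {g : Metric m M} {h : Metric n N} {φ : M → N}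
    (hφ : ContMDiff (𝓡 m) (𝓡 n) ∞ φ) (hE : dirichletEnergy g h φ ≠ ⊤)
    (hconf : IsWeaklyConformal g h φ) (hm : 0 < m) {ε : ℝ} (hε : 0 < ε)
    {ψ : ℝ → M ≃ₘ^∞⟮𝓡 m, 𝓡 m⟯ M} (hψ : IsSmoothCurveInSDiff g (Ioo (-ε) ε) ψ)
    (hψ0 : ψ 0 = Diffeomorph.refl (𝓡 m) M ∞) :
    HasDerivAt (fun t : ℝ => (dirichletEnergy g h (φ ∘ ψ t)).toReal) 0 0 := by
  have hE0 : dirichletEnergy g h (φ ∘ ψ 0) = dirichletEnergy g h φ := by rw [hψ0]; rfl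
  rw [hasDerivAt_iff_isLittleO, Asymptotics.isLittleO_iff]
  intro c hc
  set E := (dirichletEnergy g h φ).toReal with hEdef
  have hEnonneg : 0 ≤ E := ENNReal.toReal_nonneg
  -- With `η = c / (E + 1)` one has `η E ≤ c`; the added `1` covers the case `E = 0`.
  have hη : 0 < c / (E + 1) := by positivity
  filter_upwards [eventually_normSqDifferential_le g hε hψ hψ0 hη,
    Ioo_mem_nhds (by linarith : -ε < 0) hε] with t ht htI
  have hc' : 0 ≤ c / (E + 1) * |t| := by positivity
  have hlow := dirichletEnergy_le_comp hφ hconf hm (hψ.mem t htI)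
  have hup := dirichletEnergy_comp_le hφ hconf hm (hψ.mem t htI) hc' ht
  have hfin : ENNReal.ofReal (1 + c / (E + 1) * |t|) * dirichletEnergy g h φ ≠ ⊤ :=
    ENNReal.mul_ne_top ENNReal.ofReal_ne_top hE
  have hlow' := ENNReal.toReal_mono (ne_top_of_le_ne_top hfin hup) hlow
  have hup' := ENNReal.toReal_mono hfin hup
  rw [ENNReal.toReal_mul, ENNReal.toReal_ofReal (by linarith), ← hEdef] at hup'
  rw [hE0, ← hEdef, smul_zero, sub_zero, sub_zero, Real.norm_eq_abs, Real.norm_eq_abs,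
    abs_of_nonneg (by linarith)]
  have hcE : c / (E + 1) * E ≤ c := by
    rw [div_mul_eq_mul_div, div_le_iff₀ (by linarith)]
    nlinarith
  have := mul_le_mul_of_nonneg_right hcE (abs_nonneg t)
  linarith

end RestrictedHarmonicity

end RestrictedHarmonic

end

theorem corollary2p2 {m n : ℕ} {M N : Type*}
    [TopologicalSpace M] [T2Space M] [SecondCountableTopology M]
    [ChartedSpace (EuclideanSpace ℝ (Fin m)) M] [IsManifold (𝓡 m) ∞ M]
    [MeasurableSpace M] [BorelSpace M]
    [TopologicalSpace N] [T2Space N] [SecondCountableTopology N]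
    [ChartedSpace (EuclideanSpace ℝ (Fin n)) N] [IsManifold (𝓡 n) ∞ N]
    (g : RestrictedHarmonic.Metric m M) (h : RestrictedHarmonic.Metric n N)
    (φ : M → N) (hφ : ContMDiff (𝓡 m) (𝓡 n) ∞ φ)
    (hE : RestrictedHarmonic.dirichletEnergy g h φ ≠ ⊤)
    (hconf : RestrictedHarmonic.IsWeaklyConformal g h φ) :
    RestrictedHarmonic.IsRestrictedHarmonic g h φ := by
  refine ⟨hφ, hE, fun ε ψ hε hψ hψ0 => ?_⟩
  rcases Nat.eq_zero_or_pos m with rfl | hm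
  -- In dimension zero the trace is an empty sum, so the energy vanishes identically.
  · have hzero : ∀ t, RestrictedHarmonic.dirichletEnergy g h (φ ∘ ψ t) = 0 := fun t => by
      simp [RestrictedHarmonic.dirichletEnergy, RestrictedHarmonic.normSqDifferential]
    simp only [hzero, ENNReal.toReal_zero]
    exact hasDerivAt_const _ _
  · exact RestrictedHarmonic.hasDerivAt_dirichletEnergy_comp hφ hE hconf hm hε hψ hψ0
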